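/- Write $I(f)(x)=\int_0^x f(t)\,dt$, and give $C^\infty(\mathbb R)$ the topology generated by the seminorms $f\mapsto\sup_{x\in K}|D^jf(x)|$ ($j\ge 0$, $K\subseteq\mathbb R$ compact). Let $\delta\mapsto\sigma_\delta$ and $\delta\mapsto\tau_\delta$ be continuous maps from $(0,\infty)$ into $C^\infty(\mathbb R)$ such that for every $\delta>0$: - $\sigma_\delta$ maps $[0,\delta]$ into $[0,\delta]$, $\sigma_\delta(0)=0$, $D\sigma_\delta>0$ on $(0,\delta]$, and $\sigma_\delta(x)=x$ for $\delta/2\le x\le\delta$; - $\tau_\delta$ maps $[1-\delta,1]$ into $[1-\delta,1]$, $\tau_\delta(1)=1$, $D\tau_\delta>0$ on $[1-\delta,1)$, and $\tau_\delta(x)=x$ for $1-\delta\le x\le 1-\delta/2$. Then the following hold. 1. For each small enough $\delta>0$ there is a $C^\infty$ function $f\colon[0,1]\to[0,1]$ such that $f=\sigma_\delta$ on $[0,\delta]$, $f=\tau_\delta$ on $[1-\delta,1]$, and $Df>0$ on $(0,1)$. 2. Let $0<a<1$. For each small enough $\delta>0$ there is a $C^\infty$ function $f\colon[0,1]\to[0,1]$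 such that $f=\sigma_\delta$ on $[0,\delta/2]$, $f=\tau_\delta$ on $[1-\delta/2,1]$, $Df>0$ on $(0,1)$, and $I(f)(1)=a$. 3. Let $a,b\in\mathbb R$ satisfy $0<a<1$ and $a^2/2<b<a/2$. For each small enough $\delta>0$ there is a $C^\infty$ function $f\colon[0,1]\to[0,1]$ such that $f=\sigma_\delta$ on $[0,\delta/2]$, $f=\tau_\delta$ on $[1-\delta/2,1]$, $Df>0$ on $(0,1)$, $I(f)(1)=a$, and $I^2(f)(1)=b$. -/

import Mathlib

open Set Filter Topology
open scoped ContDiff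

/-- `F` restricted to the positive reals is a continuous map into `C^∞(ℝ)`, where `C^∞(ℝ)` carries
the topology generated by the seminorms `f ↦ sup_K |D^j f|` (`K` compact, `j ≥ 0`), that is, the
topology of uniform convergence of all derivatives on compact sets. -/
structure IsContinuousSmoothFamily (F : ℝ → ℝ → ℝ) : Prop where
  contDiff : ∀ δ : ℝ, 0 < δ → ContDiff ℝ ∞ (F δ)
  continuous : ∀ δ₀ : ℝ, 0 < δ₀ → ∀ (j : ℕ) (K : Set ℝ), IsCompact K →
    TendstoUniformlyOn (fun δ : ℝ => iteratedDeriv j (F δ)) (iteratedDeriv j (F δ₀)) (𝓝 δ₀) K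

/-- The standing requirements on the left endpoint pieces `σ_δ : [0, δ] → [0, δ]`, `δ > 0`. -/
structure IsLeftPieceFamily (σ : ℝ → ℝ → ℝ) : Prop where
  family : IsContinuousSmoothFamily σ
  mapsTo : ∀ δ : ℝ, 0 < δ → MapsTo (σ δ) (Icc 0 δ) (Icc 0 δ)
  map_zero : ∀ δ : ℝ, 0 < δ → σ δ 0 = 0
  deriv_pos : ∀ δ : ℝ, 0 < δ → ∀ x ∈ Ioc 0 δ, 0 < deriv (σ δ) x
  eq_self : ∀ δ : ℝ, 0 < δ → ∀ x ∈ Icc (δ / 2) δ, σ δ x = x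

/-- The standing requirements on the right endpoint pieces `τ_δ : [1 - δ, 1] → [1 - δ, 1]`,
`δ > 0`. -/
structure IsRightPieceFamily (τ : ℝ → ℝ → ℝ) : Prop where
  family : IsContinuousSmoothFamily τ
  mapsTo : ∀ δ : ℝ, 0 < δ → MapsTo (τ δ) (Icc (1 - δ) 1) (Icc (1 - δ) 1)
  map_one : ∀ δ : ℝ, 0 < δ → τ δ 1 = 1
  deriv_pos : ∀ δ : ℝ, 0 < δ → ∀ x ∈ Ico (1 - δ) 1, 0 < deriv (τ δ) x
  eq_self : ∀ δ : ℝ, 0 < δ → ∀ x ∈ Icc (1 - δ) (1 - δ / 2), τ δ x = x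

/-- `f` (through its values on `[0, 1]`) is a `C^∞` function `[0, 1] → [0, 1]` with `f = s` on
`[0, r]`, `f = t` on `[1 - r, 1]` and `Df > 0` on `(0, 1)`. -/
structure IsSmoothJoin (s t : ℝ → ℝ) (r : ℝ) (f : ℝ → ℝ) : Prop where
  contDiffOn : ContDiffOn ℝ ∞ f (Icc 0 1)
  mapsTo : MapsTo f (Icc 0 1) (Icc 0 1)
  eq_left : ∀ x ∈ Icc 0 r, f x = s x
  eq_right : ∀ x ∈ Icc (1 - r) 1, f x = t x
  deriv_pos : ∀ x ∈ Ioo (0 : ℝ) 1, 0 < deriv f x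

/-- The integral operator `I(f)(x) = ∫₀ˣ f(t) dt`. -/
noncomputable def integralOp (f : ℝ → ℝ) : ℝ → ℝ := fun x => ∫ t in (0 : ℝ)..x, f t

/-! The joins `f` with prescribed ends form a convex set, on which `f ↦ (I f 1, I² f 1)` is
affine; hence their moment pairs form a convex subset of the plane, and such a set contains
`(a, b)` as soon as it meets each of the four open quadrants at `(a, b)`. To reach the
quadrants, approximate: the step function jumping from `0` to `1` at `1 - u` has moments
`(u, u² / 2)`, and the convex hull of this parabola contains the whole region `a² / 2 < b < a / 2`.
Steep sigmoids are smooth, strictly increasing, have values in `(0, 1)` and approximate the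
steps, so mixtures of them have moments dense in the region. As `δ → 0` such a mixture can be
joined to `σ_δ` and `τ_δ` through upward transitions near the endpoints, and by dominated
convergence this changes its moments by `o(1)`. -/

open MeasureTheory

/-- The pair `(I f 1, I² f 1)` of values that the theorem prescribes. -/
noncomputable def moments (f : ℝ → ℝ) : ℝ × ℝ :=
  (integralOp f 1, integralOp (integralOp f) 1)

/-- A smooth left end `s` of a join: what is required of `σ_δ` on the single interval `[0, r]`. -/
structure IsLeftPiece (s : ℝ → ℝ) (r : ℝ) : Prop where
  contDiff : ContDiff ℝ ∞ s
  map_zero : s 0 = 0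
  deriv_pos : ∀ x ∈ Ioc 0 r, 0 < deriv s x

/-- A smooth right end `t` of a join: what is required of `τ_δ` on the single interval
`[1 - r, 1]`. -/
structure IsRightPiece (t : ℝ → ℝ) (r : ℝ) : Prop where
  contDiff : ContDiff ℝ ∞ t
  map_one : t 1 = 1
  deriv_pos : ∀ x ∈ Ico (1 - r) 1, 0 < deriv t x

/-- A smooth increasing function with values in `(0, 1)`. Such functions form the middle part of the
joins; the values at `0` and `1` are strictly inside `(0, 1)` to leave room for the end pieces. -/
structure IsProfile (φ : ℝ → ℝ) : Prop where
  contDiff : ContDiff ℝ ∞ φ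
  deriv_pos : ∀ x, 0 < deriv φ x
  mem_Ioo : ∀ x, φ x ∈ Ioo 0 1

section Moments

variable {f g : ℝ → ℝ}

lemma intervalIntegrable_of_continuousOn_unit (hf : ContinuousOn f (Icc 0 1)) {x : ℝ}
    (hx : x ∈ Icc (0 : ℝ) 1) : IntervalIntegrable f volume 0 x :=
  (hf.mono (ordConnected_Icc.uIcc_subset (left_mem_Icc.2 zero_le_one) hx)).intervalIntegrable

lemma continuousOn_integralOp (hf : ContinuousOn f (Icc 0 1)) :
    ContinuousOn (integralOp f) (Icc 0 1) := by
  rw [← uIcc_of_le (zero_le_one' ℝ)] at hf ⊢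
  exact intervalIntegral.continuousOn_primitive_interval
    (hf.integrableOn_compact isCompact_uIcc)

lemma integralOp_congr (hfg : EqOn f g (Icc 0 1)) {x : ℝ} (hx : x ∈ Icc (0 : ℝ) 1) :
    integralOp f x = integralOp g x :=
  intervalIntegral.integral_congr fun _ hy =>
    hfg (ordConnected_Icc.uIcc_subset (left_mem_Icc.2 zero_le_one) hx hy)

lemma integralOp_smul_add_smul (hf : ContinuousOn f (Icc 0 1)) (hg : ContinuousOn g (Icc 0 1))
    (p q : ℝ) {x : ℝ} (hx : x ∈ Icc (0 : ℝ) 1) :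
    integralOp (p • f + q • g) x = (p • integralOp f + q • integralOp g) x := by
  have hf' := (intervalIntegrable_of_continuousOn_unit hf hx).const_mul p
  have hg' := (intervalIntegrable_of_continuousOn_unit hg hx).const_mul q
  refine (intervalIntegral.integral_add hf' hg').trans ?_
  simp only [intervalIntegral.integral_const_mul]
  rfl

lemma moments_smul_add_smul (hf : ContinuousOn f (Icc 0 1)) (hg : ContinuousOn g (Icc 0 1))
    (p q : ℝ) : moments (p • f + q • g) = p • moments f + q • moments g := by
  have h1 : (1 : ℝ) ∈ Icc (0 : ℝ) 1 := right_mem_Icc.2 zero_le_one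
  refine Prod.ext (integralOp_smul_add_smul hf hg p q h1) ?_
  exact (integralOp_congr (fun _ => integralOp_smul_add_smul hf hg p q) h1).trans
    (integralOp_smul_add_smul (continuousOn_integralOp hf) (continuousOn_integralOp hg) p q h1)

lemma convex_image_moments {A : Set (ℝ → ℝ)} (hA : Convex ℝ A)
    (hc : ∀ f ∈ A, ContinuousOn f (Icc 0 1)) : Convex ℝ (moments '' A) := by
  rintro _ ⟨f, hf, rfl⟩ _ ⟨g, hg, rfl⟩ p q hp hq hpq
  exact ⟨p • f + q • g, hA hf hg hp hq hpq, moments_smul_add_smul (hc f hf) (hc g hg) p q⟩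

lemma abs_integralOp_le {C : ℝ} (hC : ∀ x ∈ Icc (0 : ℝ) 1, |f x| ≤ C) {x : ℝ}
    (hx : x ∈ Icc (0 : ℝ) 1) : |integralOp f x| ≤ C := by
  have hC0 : 0 ≤ C := (abs_nonneg _).trans (hC x hx)
  have h : ∀ y ∈ uIoc 0 x, ‖f y‖ ≤ C := fun y hy => by
    rw [uIoc_of_le hx.1] at hy
    exact hC y ⟨hy.1.le, hy.2.trans hx.2⟩
  calc |integralOp f x| ≤ C * |x - 0| := intervalIntegral.norm_integral_le_of_norm_le_const h
    _ ≤ C := mul_le_of_le_one_right hC0 (by rw [sub_zero, abs_of_nonneg hx.1]; exact hx.2)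

variable {ι : Type*} {l : Filter ι} [l.IsCountablyGenerated] {F : ι → ℝ → ℝ} {C : ℝ}

lemma tendsto_integralOp (hF : ∀ᶠ i in l, ContinuousOn (F i) (Icc 0 1))
    (hC : ∀ᶠ i in l, ∀ x ∈ Icc (0 : ℝ) 1, |F i x| ≤ C)
    (hlim : ∀ᵐ x, x ∈ Icc (0 : ℝ) 1 → Tendsto (F · x) l (𝓝 (f x))) {x : ℝ}
    (hx : x ∈ Icc (0 : ℝ) 1) : Tendsto (fun i => integralOp (F i) x) l (𝓝 (integralOp f x)) := by
  have hsub : uIoc 0 x ⊆ Icc 0 1 :=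
    uIoc_subset_uIcc.trans (ordConnected_Icc.uIcc_subset (left_mem_Icc.2 zero_le_one) hx)
  refine intervalIntegral.tendsto_integral_filter_of_dominated_convergence (fun _ => C) ?_ ?_
    intervalIntegrable_const ?_
  · exact hF.mono fun i hi => (hi.mono hsub).aestronglyMeasurable measurableSet_uIoc
  · exact hC.mono fun i hi => .of_forall fun y hy => hi y (hsub hy)
  · exact hlim.mono fun y hy hyx => hy (hsub hyx)

lemma tendsto_moments (hF : ∀ᶠ i in l, ContinuousOn (F i) (Icc 0 1))
    (hC : ∀ᶠ i in l, ∀ x ∈ Icc (0 : ℝ) 1, |F i x| ≤ C)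
    (hlim : ∀ᵐ x, x ∈ Icc (0 : ℝ) 1 → Tendsto (F · x) l (𝓝 (f x))) :
    Tendsto (fun i => moments (F i)) l (𝓝 (moments f)) := by
  have h1 : (1 : ℝ) ∈ Icc (0 : ℝ) 1 := right_mem_Icc.2 zero_le_one
  refine (tendsto_integralOp hF hC hlim h1).prodMk_nhds (tendsto_integralOp (C := C) ?_ ?_ ?_ h1)
  · exact hF.mono fun _ => continuousOn_integralOp
  · exact hC.mono fun _ hi _ => abs_integralOp_le hi
  · exact .of_forall fun _ => tendsto_integralOp hF hC hlim

end Moments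

section Step

variable {c : ℝ}

lemma integralOp_indicator_Ioi (hc : 0 ≤ c) {x : ℝ} (hx : 0 ≤ x) :
    integralOp ((Ioi c).indicator 1) x = max (x - c) 0 := by
  rw [integralOp, intervalIntegral.integral_of_le hx, setIntegral_indicator measurableSet_Ioi,
    Ioc_inter_Ioi, max_eq_right hc]
  simp

lemma integral_max_sub_zero (h0 : 0 ≤ c) (h1 : c ≤ 1) :
    ∫ x in (0 : ℝ)..1, max (x - c) 0 = (1 - c) ^ 2 / 2 := by
  have hcont : Continuous fun x : ℝ => max (x - c) 0 := by fun_prop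
  have hleft : ∫ x in (0 : ℝ)..c, max (x - c) 0 = ∫ _ in (0 : ℝ)..c, (0 : ℝ) := by
    refine intervalIntegral.integral_congr fun x hx => ?_
    rw [uIcc_of_le h0] at hx
    exact max_eq_right (sub_nonpos.2 hx.2)
  have hright : ∫ x in c..1, max (x - c) 0 = ∫ x in c..1, (x - c) := by
    refine intervalIntegral.integral_congr fun x hx => ?_
    rw [uIcc_of_le h1] at hx
    exact max_eq_left (sub_nonneg.2 hx.1)
  rw [← intervalIntegral.integral_add_adjacent_intervals (hcont.intervalIntegrable 0 c)
    (hcont.intervalIntegrable c 1), hleft, hright,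
    intervalIntegral.integral_comp_sub_right (fun x => x) c]
  simp

lemma moments_indicator_Ioi (h0 : 0 ≤ c) (h1 : c ≤ 1) :
    moments ((Ioi c).indicator 1) = (1 - c, (1 - c) ^ 2 / 2) := by
  refine Prod.ext ?_ ?_
  · rw [moments, integralOp_indicator_Ioi h0 zero_le_one, max_eq_left (sub_nonneg.2 h1)]
  · rw [moments, ← integral_max_sub_zero h0 h1]
    refine intervalIntegral.integral_congr fun x hx => ?_
    rw [uIcc_of_le zero_le_one] at hx
    exact integralOp_indicator_Ioi h0 hx.1

end Step

section Profile

lemma convex_setOf_isProfile : Convex ℝ {φ | IsProfile φ} := by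
  intro φ hφ ψ hψ p q hp hq hpq
  refine ⟨(contDiff_const.mul hφ.contDiff).add (contDiff_const.mul hψ.contDiff), fun x => ?_,
    fun x => convex_Ioo 0 1 (hφ.mem_Ioo x) (hψ.mem_Ioo x) hp hq hpq⟩
  have hderiv : deriv (p • φ + q • ψ) x = p • deriv φ x + q • deriv ψ x :=
    (((hφ.contDiff.differentiable (by simp) x).hasDerivAt.const_smul p).add
      ((hψ.contDiff.differentiable (by simp) x).hasDerivAt.const_smul q)).deriv
  rw [hderiv]
  exact convex_Ioi (0 : ℝ) (hφ.deriv_pos x) (hψ.deriv_pos x) hp hq hpq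

lemma isProfile_sigmoid (c : ℝ) {k : ℝ} (hk : 0 < k) :
    IsProfile fun x => Real.sigmoid (k * (x - c)) where
  contDiff := (contDiff_sigmoid.of_le le_top).comp
    (contDiff_const.mul (contDiff_id.sub contDiff_const))
  deriv_pos x := by
    have hlin : HasDerivAt (fun x => k * (x - c)) (k * 1) x :=
      ((hasDerivAt_id x).sub_const c).const_mul k
    have h := (Real.hasDerivAt_sigmoid (k * (x - c))).comp x hlin
    rw [show deriv (fun x => Real.sigmoid (k * (x - c))) x = _ from h.deriv]
    have h0 := Real.sigmoid_pos (k * (x - c))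
    have h1 := sub_pos.2 (Real.sigmoid_lt_one (k * (x - c)))
    positivity
  mem_Ioo x := ⟨Real.sigmoid_pos _, Real.sigmoid_lt_one _⟩

lemma tendsto_sigmoid_mul_sub {c x : ℝ} (hx : x ≠ c) :
    Tendsto (fun k => Real.sigmoid (k * (x - c))) atTop (𝓝 ((Ioi c).indicator 1 x)) := by
  rcases hx.lt_or_gt with h | h
  · rw [indicator_of_notMem (notMem_Ioi.2 h.le)]
    exact Real.tendsto_sigmoid_atBot.comp (tendsto_id.atTop_mul_const_of_neg (sub_neg.2 h))
  · rw [indicator_of_mem (mem_Ioi.2 h)]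
    exact Real.tendsto_sigmoid_atTop.comp (tendsto_id.atTop_mul_const (sub_pos.2 h))

lemma parabola_mem_closure_moments_isProfile {u : ℝ} (hu : u ∈ Icc (0 : ℝ) 1) :
    (u, u ^ 2 / 2) ∈ closure (moments '' {φ | IsProfile φ}) := by
  have hstep : moments ((Ioi (1 - u)).indicator 1) = (u, u ^ 2 / 2) := by
    rw [moments_indicator_Ioi (by linarith [hu.2]) (by linarith [hu.1]), sub_sub_cancel]
  have hprofile : ∀ᶠ k : ℝ in atTop, IsProfile fun x => Real.sigmoid (k * (x - (1 - u))) :=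
    (eventually_gt_atTop 0).mono fun _ => isProfile_sigmoid (1 - u)
  rw [← hstep]
  refine mem_closure_of_tendsto (tendsto_moments (C := 1) ?_ ?_ ?_)
    (hprofile.mono fun k => mem_image_of_mem moments)
  · exact hprofile.mono fun k hk => hk.contDiff.continuous.continuousOn
  · refine hprofile.mono fun k hk x _ => ?_
    rw [abs_of_pos (hk.mem_Ioo x).1]
    exact (hk.mem_Ioo x).2.le
  · exact (volume.ae_ne (1 - u)).mono fun x hx _ => tendsto_sigmoid_mul_sub hx

/-- The region of the admissible pairs `(a, b)`, between the parabola and its chord over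
`[0, 1]`. -/
def momentRegion : Set (ℝ × ℝ) :=
  {p | p.1 ^ 2 / 2 < p.2 ∧ p.2 < p.1 / 2}

lemma isOpen_momentRegion : IsOpen momentRegion :=
  (isOpen_lt ((continuous_fst.pow 2).div_const 2) continuous_snd).inter
    (isOpen_lt continuous_snd (continuous_fst.div_const 2))

lemma momentRegion_subset_closure_moments_isProfile :
    momentRegion ⊆ closure (moments '' {φ | IsProfile φ}) := by
  rintro ⟨a, b⟩ ⟨hb, hb'⟩
  have ha0 : 0 ≤ a := by nlinarith
  have ha1 : a ≤ 1 := by nlinarith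
  have hconv : Convex ℝ (closure (moments '' {φ | IsProfile φ})) :=
    (convex_image_moments convex_setOf_isProfile fun φ hφ =>
      (IsProfile.contDiff hφ).continuous.continuousOn).closure
  have hparabola := parabola_mem_closure_moments_isProfile ⟨ha0, ha1⟩
  have hchord : (a, a / 2) ∈ closure (moments '' {φ | IsProfile φ}) := by
    convert hconv (parabola_mem_closure_moments_isProfile (left_mem_Icc.2 zero_le_one))
      (parabola_mem_closure_moments_isProfile (right_mem_Icc.2 zero_le_one))
      (sub_nonneg.2 ha1) ha0 (sub_add_cancel 1 a) using 1
    ext <;> simp [div_eq_mul_inv]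
  refine hconv.segment_subset hparabola hchord ?_
  rw [← Prod.image_mk_segment_right, segment_eq_Icc (hb.trans hb').le]
  exact mem_image_of_mem _ ⟨hb.le, hb'.le⟩

end Profile

section Splice

/-- The smooth transition from `f` on `(-∞, u]` to `g` on `[v, ∞)`, for `u < v`. -/
noncomputable def splice (u v : ℝ) (f g : ℝ → ℝ) (x : ℝ) : ℝ :=
  f x + Real.smoothTransition ((x - u) / (v - u)) * (g x - f x)

variable {u v : ℝ} {f g : ℝ → ℝ} {x : ℝ}

lemma splice_of_le (huv : u < v) (hx : x ≤ u) : splice u v f g x = f x := by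
  rw [splice, Real.smoothTransition.zero_of_nonpos
    (div_nonpos_of_nonpos_of_nonneg (sub_nonpos.2 hx) (sub_pos.2 huv).le), zero_mul, add_zero]

lemma splice_of_ge (huv : u < v) (hx : v ≤ x) : splice u v f g x = g x := by
  rw [splice, Real.smoothTransition.one_of_one_le
    ((one_le_div (sub_pos.2 huv)).2 (sub_le_sub_right hx u)), one_mul, add_sub_cancel]

lemma contDiff_splice (hf : ContDiff ℝ ∞ f) (hg : ContDiff ℝ ∞ g) :
    ContDiff ℝ ∞ (splice u v f g) :=
  hf.add ((Real.smoothTransition.contDiff.comp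
    ((contDiff_id.sub contDiff_const).div_const _)).mul (hg.sub hf))

/-- The derivative is a convex combination of `f'` and `g'` plus the derivative of the transition
times `g - f`, so an upward jump from `f` to `g` does no harm. -/
lemma deriv_splice_pos (huv : u < v) (hf : Differentiable ℝ f) (hg : Differentiable ℝ g)
    (hfg : x ∈ Icc u v → f x ≤ g x) (hf' : x ≤ v → 0 < deriv f x)
    (hg' : u ≤ x → 0 < deriv g x) : 0 < deriv (splice u v f g) x := by
  rcases lt_or_ge x u with hxu | hux
  · have h : splice u v f g =ᶠ[𝓝 x] f := by
      filter_upwards [Iio_mem_nhds hxu] with y hy using splice_of_le huv (le_of_lt hy)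
    exact h.deriv_eq ▸ hf' (hxu.trans huv).le
  rcases lt_or_ge v x with hvx | hxv
  · have h : splice u v f g =ᶠ[𝓝 x] g := by
      filter_upwards [Ioi_mem_nhds hvx] with y hy using splice_of_ge huv (le_of_lt hy)
    exact h.deriv_eq ▸ hg' (huv.trans hvx).le
  set w : ℝ → ℝ := fun y => Real.smoothTransition ((y - u) / (v - u))
  have hw_diff : DifferentiableAt ℝ w x :=
    (Real.smoothTransition.contDiff (n := 1).comp
      ((contDiff_id.sub contDiff_const).div_const _)).differentiable one_ne_zero x
  have hw_mono : Monotone w := Real.smoothTransition.monotone.comp fun y z hyz =>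
    div_le_div_of_nonneg_right (sub_le_sub_right hyz u) (sub_pos.2 huv).le
  have hderiv : deriv (splice u v f g) x =
      ((1 - w x) • deriv f x + w x • deriv g x) + deriv w x * (g x - f x) := by
    refine ((hf x).hasDerivAt.add (hw_diff.hasDerivAt.mul
      ((hg x).hasDerivAt.sub (hf x).hasDerivAt))).deriv.trans ?_
    simp only [Pi.sub_apply, smul_eq_mul]
    ring
  rw [hderiv]
  refine add_pos_of_pos_of_nonneg ?_
    (mul_nonneg hw_mono.deriv_nonneg (sub_nonneg.2 (hfg ⟨hux, hxv⟩)))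
  exact convex_Ioi (0 : ℝ) (hf' hxv) (hg' hux) (sub_nonneg.2 (Real.smoothTransition.le_one _))
    (Real.smoothTransition.nonneg _) (sub_add_cancel 1 _)

end Splice

section Join

variable {s t φ f : ℝ → ℝ} {r r' : ℝ}

lemma IsLeftPiece.monotoneOn (hs : IsLeftPiece s r) : MonotoneOn s (Icc 0 r) :=
  (strictMonoOn_of_deriv_pos (convex_Icc 0 r) hs.contDiff.continuous.continuousOn fun x hx =>
    hs.deriv_pos x (by rw [interior_Icc] at hx; exact Ioo_subset_Ioc_self hx)).monotoneOn

lemma IsRightPiece.monotoneOn (ht : IsRightPiece t r) : MonotoneOn t (Icc (1 - r) 1) :=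
  (strictMonoOn_of_deriv_pos (convex_Icc _ 1) ht.contDiff.continuous.continuousOn fun x hx =>
    ht.deriv_pos x (by rw [interior_Icc] at hx; exact Ioo_subset_Ico_self hx)).monotoneOn

lemma IsProfile.monotone (hφ : IsProfile φ) : Monotone φ :=
  (strictMono_of_deriv_pos hφ.deriv_pos).monotone

lemma IsSmoothJoin.mono (hf : IsSmoothJoin s t r f) (hr : r' ≤ r) : IsSmoothJoin s t r' f where
  __ := hf
  eq_left x hx := hf.eq_left x ⟨hx.1, hx.2.trans hr⟩
  eq_right x hx := hf.eq_right x ⟨(sub_le_sub_left hr 1).trans hx.1, hx.2⟩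

lemma convex_setOf_isSmoothJoin : Convex ℝ {f | IsSmoothJoin s t r f} := by
  intro f hf g hg p q hp hq hpq
  refine ⟨(contDiffOn_const.mul hf.contDiffOn).add (contDiffOn_const.mul hg.contDiffOn),
    fun x hx => convex_Icc 0 1 (hf.mapsTo hx) (hg.mapsTo hx) hp hq hpq, fun x hx => ?_,
    fun x hx => ?_, fun x hx => ?_⟩
  · simp only [Pi.add_apply, Pi.smul_apply, hf.eq_left x hx, hg.eq_left x hx,
      Convex.combo_self hpq]
  · simp only [Pi.add_apply, Pi.smul_apply, hf.eq_right x hx, hg.eq_right x hx,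
      Convex.combo_self hpq]
  · have hdiff : ∀ {h}, IsSmoothJoin s t r h → DifferentiableAt ℝ h x := fun hh =>
      (hh.contDiffOn.contDiffAt (Icc_mem_nhds hx.1 hx.2)).differentiableAt (by simp)
    have hderiv : deriv (p • f + q • g) x = p • deriv f x + q • deriv g x :=
      (((hdiff hf).hasDerivAt.const_smul p).add ((hdiff hg).hasDerivAt.const_smul q)).deriv
    rw [hderiv]
    exact convex_Ioi (0 : ℝ) (hf.deriv_pos x hx) (hg.deriv_pos x hx) hp hq hpq

lemma mapsTo_Icc_of_deriv_pos {a b : ℝ} (hf : ContinuousOn f (Icc a b))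
    (hd : ∀ x ∈ Ioo a b, 0 < deriv f x) : MapsTo f (Icc a b) (Icc (f a) (f b)) :=
  (strictMonoOn_of_deriv_pos (convex_Icc a b) hf
    (by simpa only [interior_Icc] using hd)).monotoneOn.mapsTo_Icc

lemma isSmoothJoin_splice (hr : 0 < r) (hrr' : r < r') (hr' : r' ≤ 1 / 2)
    (hs : IsLeftPiece s r') (ht : IsRightPiece t r') (hφ : IsProfile φ) (hsφ : s r' ≤ φ 0)
    (hφt : φ 1 ≤ t (1 - r')) :
    IsSmoothJoin s t r (splice r r' s (splice (1 - r') (1 - r) φ t)) := by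
  set g := splice (1 - r') (1 - r) φ t
  have hg_left : ∀ x ≤ 1 - r', g x = φ x := fun x => splice_of_le (by linarith)
  have hg_right : ∀ x, 1 - r ≤ x → g x = t x := fun x => splice_of_ge (by linarith)
  have hg_smooth : ContDiff ℝ ∞ g := contDiff_splice hφ.contDiff ht.contDiff
  have hf_smooth : ContDiff ℝ ∞ (splice r r' s g) := contDiff_splice hs.contDiff hg_smooth
  have hsg : ∀ x ∈ Icc r r', s x ≤ g x := fun x hx => by
    rw [hg_left x (by linarith [hx.2])]
    calc s x ≤ s r' :=
          hs.monotoneOn ⟨hr.le.trans hx.1, hx.2⟩ ⟨(hr.trans hrr').le, le_rfl⟩ hx.2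
      _ ≤ φ 0 := hsφ
      _ ≤ φ x := hφ.monotone (hr.le.trans hx.1)
  have hφt' : ∀ x ∈ Icc (1 - r') (1 - r), φ x ≤ t x := fun x hx => by
    have hx1 : x ≤ 1 := by linarith [hx.2]
    calc φ x ≤ φ 1 := hφ.monotone hx1
      _ ≤ t (1 - r') := hφt
      _ ≤ t x := ht.monotoneOn ⟨le_rfl, by linarith⟩ ⟨hx.1, hx1⟩ hx.1
  have hg_deriv : ∀ x < 1, 0 < deriv g x := fun x hx =>
    deriv_splice_pos (by linarith) (hφ.contDiff.differentiable (by simp))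
      (ht.contDiff.differentiable (by simp)) (hφt' x) (fun _ => hφ.deriv_pos x)
      (fun hx' => ht.deriv_pos x ⟨hx', hx⟩)
  have hf_deriv : ∀ x ∈ Ioo (0 : ℝ) 1, 0 < deriv (splice r r' s g) x := fun x hx =>
    deriv_splice_pos hrr' (hs.contDiff.differentiable (by simp))
      (hg_smooth.differentiable (by simp)) (hsg x) (fun hx' => hs.deriv_pos x ⟨hx.1, hx'⟩)
      (fun _ => hg_deriv x hx.2)
  have hf_left : ∀ x ∈ Icc 0 r, splice r r' s g x = s x := fun x hx => splice_of_le hrr' hx.2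
  have hf_right : ∀ x ∈ Icc (1 - r) 1, splice r r' s g x = t x := fun x hx => by
    rw [splice_of_ge hrr' (by linarith [hx.1]), hg_right x hx.1]
  refine ⟨hf_smooth.contDiffOn, ?_, hf_left, hf_right, hf_deriv⟩
  have h := mapsTo_Icc_of_deriv_pos hf_smooth.continuous.continuousOn hf_deriv
  rwa [hf_left 0 ⟨le_rfl, hr.le⟩, hs.map_zero, hf_right 1 ⟨by linarith, le_rfl⟩, ht.map_one] at h

lemma splice_splice_eqOn (hrr' : r < r') :
    EqOn (splice r r' s (splice (1 - r') (1 - r) φ t)) φ (Icc r' (1 - r')) := fun x hx => by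
  rw [splice_of_ge hrr' hx.1, splice_of_le (by linarith) hx.2]

lemma eventually_nhdsGT_forall_Icc_pos {g : ℝ → ℝ} (hg : Continuous g) (hr : 0 < g r) :
    ∀ᶠ r' in 𝓝[>] r, ∀ x ∈ Icc r r', 0 < g x := by
  have h : ∀ᶠ x in 𝓝[≥] r, 0 < g x :=
    nhdsWithin_le_nhds (hg.continuousAt.eventually (lt_mem_nhds hr))
  obtain ⟨c, hc, hsub⟩ := mem_nhdsGE_iff_exists_Ico_subset.1 h
  filter_upwards [Ioo_mem_nhdsGT hc] with r' hr' x hx using hsub ⟨hx.1, hx.2.trans_lt hr'.2⟩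

lemma IsLeftPiece.eventually_nhdsGT (hs : IsLeftPiece s r) (hr : 0 < r) :
    ∀ᶠ r' in 𝓝[>] r, IsLeftPiece s r' := by
  filter_upwards [eventually_nhdsGT_forall_Icc_pos (hs.contDiff.continuous_deriv (by simp))
    (hs.deriv_pos r ⟨hr, le_rfl⟩)] with r' hr'
  refine ⟨hs.contDiff, hs.map_zero, fun x hx => ?_⟩
  rcases le_total x r with h | h
  exacts [hs.deriv_pos x ⟨hx.1, h⟩, hr' x ⟨h, hx.2⟩]

lemma IsRightPiece.eventually_nhdsGT (ht : IsRightPiece t r) (hr : 0 < r) :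
    ∀ᶠ r' in 𝓝[>] r, IsRightPiece t r' := by
  have hcont : Continuous fun x => deriv t (1 - x) :=
    (ht.contDiff.continuous_deriv (by simp)).comp (continuous_const.sub continuous_id)
  filter_upwards [eventually_nhdsGT_forall_Icc_pos hcont
    (ht.deriv_pos (1 - r) ⟨le_rfl, by linarith⟩)] with r' hr'
  refine ⟨ht.contDiff, ht.map_one, fun x hx => ?_⟩
  rcases le_total (1 - r) x with h | h
  · exact ht.deriv_pos x ⟨h, hx.2⟩
  · simpa only [sub_sub_cancel] using hr' (1 - x) ⟨by linarith, by linarith [hx.1]⟩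

lemma exists_isSmoothJoin_eqOn (hr : 0 < r) (hr' : r < r') (hr2 : r' ≤ 1 / 2)
    (hs : IsLeftPiece s r) (ht : IsRightPiece t r) (hφ : IsProfile φ) (hsφ : s r < φ 0)
    (hφt : φ 1 < t (1 - r)) :
    ∃ f, IsSmoothJoin s t r f ∧ EqOn f φ (Icc r' (1 - r')) := by
  have hsφ' : ∀ᶠ ρ in 𝓝[>] r, s ρ < φ 0 := nhdsWithin_le_nhds
    (hs.contDiff.continuous.continuousAt.eventually (gt_mem_nhds hsφ))
  have hφt' : ∀ᶠ ρ in 𝓝[>] r, φ 1 < t (1 - ρ) := nhdsWithin_le_nhds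
    ((ht.contDiff.continuous.comp (continuous_const.sub continuous_id)).continuousAt.eventually
      (lt_mem_nhds hφt))
  obtain ⟨ρ, hsρ, htρ, hsφρ, hφtρ, hrρ, hρ⟩ := (((hs.eventually_nhdsGT hr).and <|
    (ht.eventually_nhdsGT hr).and <| hsφ'.and <| hφt'.and <| Ioo_mem_nhdsGT hr')).exists
  refine ⟨_, isSmoothJoin_splice hr hrρ (hρ.le.trans hr2) hsρ htρ hφ hsφρ.le hφtρ.le, ?_⟩
  exact (splice_splice_eqOn hrρ).mono (Icc_subset_Icc hρ.le (by linarith))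

end Join

lemma mem_of_convex_of_inter_quadrants_nonempty {S : Set (ℝ × ℝ)} (hS : Convex ℝ S) {a b : ℝ}
    (hll : (S ∩ Iio a ×ˢ Iio b).Nonempty) (hlr : (S ∩ Ioi a ×ˢ Iio b).Nonempty)
    (hul : (S ∩ Iio a ×ˢ Ioi b).Nonempty) (hur : (S ∩ Ioi a ×ˢ Ioi b).Nonempty) :
    (a, b) ∈ S := by
  have hcross : ∀ H : Set ℝ, Convex ℝ H → (S ∩ Iio a ×ˢ H).Nonempty → (S ∩ Ioi a ×ˢ H).Nonempty →
      ∃ y ∈ H, (a, y) ∈ S := by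
    rintro H hH ⟨p, hpS, hpa, hpH⟩ ⟨q, hqS, hqa, hqH⟩
    have hproj : Convex ℝ (Prod.fst '' (S ∩ univ ×ˢ H)) :=
      (hS.inter (convex_univ.prod hH)).linear_image (LinearMap.fst ℝ ℝ ℝ)
    obtain ⟨⟨_, y⟩, ⟨hyS, -, hyH⟩, rfl⟩ := hproj.ordConnected.out
      ⟨p, ⟨hpS, trivial, hpH⟩, rfl⟩ ⟨q, ⟨hqS, trivial, hqH⟩, rfl⟩ ⟨le_of_lt hpa, le_of_lt hqa⟩
    exact ⟨y, hyH, hyS⟩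
  obtain ⟨y, hyb, hy⟩ := hcross (Iio b) (convex_Iio b) hll hlr
  obtain ⟨z, hbz, hz⟩ := hcross (Ioi b) (convex_Ioi b) hul hur
  have hyz : (a, b) ∈ segment ℝ (a, y) (a, z) := by
    rw [← Prod.image_mk_segment_right, segment_eq_Icc (hyb.trans hbz).le]
    exact mem_image_of_mem _ ⟨le_of_lt hyb, le_of_lt hbz⟩
  exact hS.segment_subset hy hz hyz

section Families

variable {ι : Type*} {l : Filter ι} {r : ι → ℝ} {s t : ι → ℝ → ℝ}

lemma eventually_exists_isSmoothJoin_eqOn (hr : Tendsto r l (𝓝[>] 0))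
    (hs : ∀ᶠ i in l, IsLeftPiece (s i) (r i)) (ht : ∀ᶠ i in l, IsRightPiece (t i) (r i))
    (hs0 : Tendsto (fun i => s i (r i)) l (𝓝 0))
    (ht1 : Tendsto (fun i => t i (1 - r i)) l (𝓝 1)) {φ : ℝ → ℝ} (hφ : IsProfile φ) :
    ∀ᶠ i in l, ∃ f, IsSmoothJoin (s i) (t i) (r i) f ∧ EqOn f φ (Icc (2 * r i) (1 - 2 * r i)) := by
  filter_upwards [hs, ht, hs0.eventually_lt_const (hφ.mem_Ioo 0).1,
    ht1.eventually_const_lt (hφ.mem_Ioo 1).2,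
    hr.eventually (Ioo_mem_nhdsGT (by norm_num : (0 : ℝ) < 1 / 4))] with i hsi hti hsφ hφt hri
  exact exists_isSmoothJoin_eqOn hri.1 (by linarith [hri.1]) (by linarith [hri.2]) hsi hti hφ
    hsφ hφt

variable [l.IsCountablyGenerated]

lemma tendsto_moments_of_eqOn {f : ι → ℝ → ℝ} {φ : ℝ → ℝ} (hr : Tendsto r l (𝓝 0))
    (hf : ∀ᶠ i in l, IsSmoothJoin (s i) (t i) (r i) (f i))
    (hfφ : ∀ᶠ i in l, EqOn (f i) φ (Icc (2 * r i) (1 - 2 * r i))) :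
    Tendsto (fun i => moments (f i)) l (𝓝 (moments φ)) := by
  refine tendsto_moments (C := 1) (hf.mono fun i hi => hi.contDiffOn.continuousOn) ?_ ?_
  · refine hf.mono fun i hi x hx => ?_
    rw [abs_of_nonneg (hi.mapsTo hx).1]
    exact (hi.mapsTo hx).2
  filter_upwards [volume.ae_ne 0, volume.ae_ne 1] with x hx0 hx1 hx
  have hpos : 0 < min x (1 - x) / 2 :=
    half_pos (lt_min (hx.1.lt_of_ne' hx0) (sub_pos.2 (hx.2.lt_of_ne hx1)))
  refine tendsto_const_nhds.congr' ?_
  filter_upwards [hfφ, hr.eventually_lt_const hpos] with i hi hri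
  have hl := min_le_left x (1 - x)
  have hu := min_le_right x (1 - x)
  exact (hi ⟨by linarith, by linarith⟩).symm

variable (hr : Tendsto r l (𝓝[>] 0)) (hs : ∀ᶠ i in l, IsLeftPiece (s i) (r i))
  (ht : ∀ᶠ i in l, IsRightPiece (t i) (r i)) (hs0 : Tendsto (fun i => s i (r i)) l (𝓝 0))
  (ht1 : Tendsto (fun i => t i (1 - r i)) l (𝓝 1))

include hr hs ht hs0 ht1

lemma eventually_moments_isSmoothJoin_inter_nonempty {U : Set (ℝ × ℝ)} (hU : IsOpen U)
    (hUR : (U ∩ momentRegion).Nonempty) :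
    ∀ᶠ i in l, (moments '' {f | IsSmoothJoin (s i) (t i) (r i) f} ∩ U).Nonempty := by
  rcases l.eq_or_neBot with rfl | _
  · exact eventually_bot
  obtain ⟨p, hpU, hpR⟩ := hUR
  obtain ⟨_, hφU, φ, hφ, rfl⟩ :=
    mem_closure_iff.1 (momentRegion_subset_closure_moments_isProfile hpR) U hU hpU
  obtain ⟨f, hf⟩ := (eventually_exists_isSmoothJoin_eqOn hr hs ht hs0 ht1 hφ).choice
  have hlim := tendsto_moments_of_eqOn (tendsto_nhds_of_tendsto_nhdsWithin hr)
    (hf.mono fun _ => And.left) (hf.mono fun _ => And.right)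
  filter_upwards [hf, hlim.eventually (hU.mem_nhds hφU)] with i hi hiU
  exact ⟨moments (f i), ⟨f i, hi.1, rfl⟩, hiU⟩

lemma eventually_exists_isSmoothJoin_moments_eq {p : ℝ × ℝ} (hp : p ∈ momentRegion) :
    ∀ᶠ i in l, ∃ f, IsSmoothJoin (s i) (t i) (r i) f ∧ moments f = p := by
  have hquadrant : ∀ A B : Set ℝ, IsOpen A → IsOpen B → p.1 ∈ closure A → p.2 ∈ closure B →
      ∀ᶠ i in l, (moments '' {f | IsSmoothJoin (s i) (t i) (r i) f} ∩ A ×ˢ B).Nonempty := by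
    intro A B hA hB hpA hpB
    refine eventually_moments_isSmoothJoin_inter_nonempty hr hs ht hs0 ht1 (hA.prod hB) ?_
    rw [inter_comm]
    have hpAB : p ∈ closure (A ×ˢ B) := by rw [closure_prod_eq]; exact ⟨hpA, hpB⟩
    exact mem_closure_iff.1 hpAB _ isOpen_momentRegion hp
  have hlt : ∀ x : ℝ, x ∈ closure (Iio x) := fun x => by simp
  have hgt : ∀ x : ℝ, x ∈ closure (Ioi x) := fun x => by simp
  filter_upwards [hquadrant _ _ isOpen_Iio isOpen_Iio (hlt _) (hlt _),
    hquadrant _ _ isOpen_Ioi isOpen_Iio (hgt _) (hlt _),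
    hquadrant _ _ isOpen_Iio isOpen_Ioi (hlt _) (hgt _),
    hquadrant _ _ isOpen_Ioi isOpen_Ioi (hgt _) (hgt _)] with i hll hlr hul hur
  exact mem_of_convex_of_inter_quadrants_nonempty
    (convex_image_moments convex_setOf_isSmoothJoin fun f hf =>
      (IsSmoothJoin.contDiffOn hf).continuousOn) hll hlr hul hur

end Families

lemma IsLeftPieceFamily.eventually_isLeftPiece {σ : ℝ → ℝ → ℝ} (hσ : IsLeftPieceFamily σ) :
    ∀ᶠ δ in 𝓝[>] 0, IsLeftPiece (σ δ) δ := by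
  filter_upwards [self_mem_nhdsWithin] with δ hδ
  exact ⟨hσ.family.contDiff δ hδ, hσ.map_zero δ hδ, hσ.deriv_pos δ hδ⟩

lemma IsRightPieceFamily.eventually_isRightPiece {τ : ℝ → ℝ → ℝ} (hτ : IsRightPieceFamily τ) :
    ∀ᶠ δ in 𝓝[>] 0, IsRightPiece (τ δ) δ := by
  filter_upwards [self_mem_nhdsWithin] with δ hδ
  exact ⟨hτ.family.contDiff δ hδ, hτ.map_one δ hδ, hτ.deriv_pos δ hδ⟩

lemma IsLeftPieceFamily.tendsto_apply_self {σ : ℝ → ℝ → ℝ} (hσ : IsLeftPieceFamily σ) :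
    Tendsto (fun δ => σ δ δ) (𝓝[>] 0) (𝓝 0) := by
  refine (tendsto_nhdsWithin_of_tendsto_nhds tendsto_id).congr' ?_
  filter_upwards [self_mem_nhdsWithin] with δ hδ
  exact (hσ.eq_self δ hδ δ ⟨half_le_self (le_of_lt hδ), le_rfl⟩).symm

lemma IsRightPieceFamily.tendsto_apply_one_sub {τ : ℝ → ℝ → ℝ} (hτ : IsRightPieceFamily τ) :
    Tendsto (fun δ => τ δ (1 - δ)) (𝓝[>] 0) (𝓝 1) := by
  have h : Tendsto (fun δ : ℝ => 1 - δ) (𝓝 0) (𝓝 1) := by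
    simpa only [sub_zero, id] using (tendsto_id (x := 𝓝 (0 : ℝ))).const_sub 1
  refine (tendsto_nhdsWithin_of_tendsto_nhds h).congr' ?_
  filter_upwards [self_mem_nhdsWithin] with δ hδ
  exact (hτ.eq_self δ hδ (1 - δ)
    ⟨le_rfl, sub_le_sub_left (half_le_self (le_of_lt hδ)) 1⟩).symm

lemma exists_pos_forall_of_eventually_nhdsGT {P : ℝ → Prop} (h : ∀ᶠ δ in 𝓝[>] 0, P δ) :
    ∃ δ₀ : ℝ, 0 < δ₀ ∧ ∀ δ : ℝ, 0 < δ → δ < δ₀ → P δ := by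
  simpa only [mem_Ioo, and_imp] using (nhdsGT_basis 0).eventually_iff.1 h

theorem corollaryc_general (σ τ : ℝ → ℝ → ℝ) (hσ : ∀ᶠ δ in 𝓝[>] 0, IsLeftPiece (σ δ) δ)
    (hτ : ∀ᶠ δ in 𝓝[>] 0, IsRightPiece (τ δ) δ) (hσ0 : Tendsto (fun δ => σ δ δ) (𝓝[>] 0) (𝓝 0))
    (hτ1 : Tendsto (fun δ => τ δ (1 - δ)) (𝓝[>] 0) (𝓝 1)) :
    (∃ δ₀ : ℝ, 0 < δ₀ ∧ ∀ δ : ℝ, 0 < δ → δ < δ₀ →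
      ∃ f : ℝ → ℝ, IsSmoothJoin (σ δ) (τ δ) δ f) ∧
    (∀ a : ℝ, 0 < a → a < 1 →
      ∃ δ₀ : ℝ, 0 < δ₀ ∧ ∀ δ : ℝ, 0 < δ → δ < δ₀ →
        ∃ f : ℝ → ℝ, IsSmoothJoin (σ δ) (τ δ) δ f ∧ integralOp f 1 = a) ∧
    (∀ a b : ℝ, a ^ 2 / 2 < b → b < a / 2 →
      ∃ δ₀ : ℝ, 0 < δ₀ ∧ ∀ δ : ℝ, 0 < δ → δ < δ₀ →
        ∃ f : ℝ → ℝ, IsSmoothJoin (σ δ) (τ δ) δ f ∧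
          integralOp f 1 = a ∧ integralOp (integralOp f) 1 = b) := by
  have prescribe_both : ∀ a b : ℝ, a ^ 2 / 2 < b → b < a / 2 → ∀ᶠ δ in 𝓝[>] 0,
      ∃ f, IsSmoothJoin (σ δ) (τ δ) δ f ∧ integralOp f 1 = a ∧ integralOp (integralOp f) 1 = b := by
    intro a b hab hba
    simpa only [moments, Prod.mk.injEq, id] using eventually_exists_isSmoothJoin_moments_eq
      tendsto_id hσ hτ hσ0 hτ1 (p := (a, b)) ⟨hab, hba⟩
  have prescribe_first : ∀ a : ℝ, 0 < a → a < 1 → ∀ᶠ δ in 𝓝[>] 0,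
      ∃ f, IsSmoothJoin (σ δ) (τ δ) δ f ∧ integralOp f 1 = a := by
    intro a ha0 ha1
    obtain ⟨b, hab, hba⟩ := exists_between (show a ^ 2 / 2 < a / 2 by nlinarith)
    exact (prescribe_both a b hab hba).mono fun δ ⟨f, hf, hfa, _⟩ => ⟨f, hf, hfa⟩
  refine ⟨exists_pos_forall_of_eventually_nhdsGT ?_, fun a ha0 ha1 => ?_, fun a b hab hba => ?_⟩
  · exact (prescribe_first (1 / 2) (by norm_num) (by norm_num)).mono fun δ ⟨f, hf, _⟩ => ⟨f, hf⟩
  · exact exists_pos_forall_of_eventually_nhdsGT (prescribe_first a ha0 ha1)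
  · exact exists_pos_forall_of_eventually_nhdsGT (prescribe_both a b hab hba)

theorem corollaryc (σ τ : ℝ → ℝ → ℝ) (hσ : IsLeftPieceFamily σ) (hτ : IsRightPieceFamily τ) :
    (∃ δ₀ : ℝ, 0 < δ₀ ∧ ∀ δ : ℝ, 0 < δ → δ < δ₀ →
      ∃ f : ℝ → ℝ, IsSmoothJoin (σ δ) (τ δ) δ f) ∧
    (∀ a : ℝ, 0 < a → a < 1 →
      ∃ δ₀ : ℝ, 0 < δ₀ ∧ ∀ δ : ℝ, 0 < δ → δ < δ₀ →
        ∃ f : ℝ → ℝ, IsSmoothJoin (σ δ) (τ δ) (δ / 2) f ∧ integralOp f 1 = a) ∧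
    (∀ a b : ℝ, 0 < a → a < 1 → a ^ 2 / 2 < b → b < a / 2 →
      ∃ δ₀ : ℝ, 0 < δ₀ ∧ ∀ δ : ℝ, 0 < δ → δ < δ₀ →
        ∃ f : ℝ → ℝ, IsSmoothJoin (σ δ) (τ δ) (δ / 2) f ∧
          integralOp f 1 = a ∧ integralOp (integralOp f) 1 = b) := by
  obtain ⟨h₁, h₂, h₃⟩ := corollaryc_general σ τ hσ.eventually_isLeftPiece
    hτ.eventually_isRightPiece hσ.tendsto_apply_self hτ.tendsto_apply_one_sub
  have halve : ∀ δ : ℝ, 0 < δ → ∀ P : (ℝ → ℝ) → Prop,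
      (∃ f, IsSmoothJoin (σ δ) (τ δ) δ f ∧ P f) → ∃ f, IsSmoothJoin (σ δ) (τ δ) (δ / 2) f ∧ P f :=
    fun δ hδ P ⟨f, hf, hP⟩ => ⟨f, hf.mono (half_le_self hδ.le), hP⟩
  refine ⟨h₁, fun a ha0 ha1 => (h₂ a ha0 ha1).imp ?_,
    fun a b _ _ hab hba => (h₃ a b hab hba).imp ?_⟩
  all_goals exact fun _ h => ⟨h.1, fun δ hδ hlt => halve δ hδ _ (h.2 δ hδ hlt)⟩
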